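/- Setting. A digraph $\mathcal G=(\mathcal V,\mathcal E)$ has $n>1$ nodes; $\mathcal N_i=\{j:(j,i)\in\mathcal E\}$. For $S\subset\mathcal V$ let $\mathcal X^r_S$ be the set of nodes of $S$ with at least $r$ neighbors outside $S$. $\mathcal G$ is $(r,s)$-robust ($r,s<n$) if for all nonempty disjoint $S_1,S_2\subset\mathcal V$ we have $\mathcal X^r_{S_1}=S_1$, or $\mathcal X^r_{S_2}=S_2$, or $|\mathcal X^r_{S_1}|+|\mathcal X^r_{S_2}|\ge s$; it is $r$-robust if it is $(r,1)$-robust. Let $T>0$ be a sampling period, $r$ a desired velocity, $\delta_{ij}$ desired relative positions with $\delta_{ij}+\delta_{jl}=\delta_{il}$, $\alpha_i>0$ gains, $a_{ij}[k]$ edge weights with $a_{ij}[k]\ge\gamma>0$ for $(j,i)\in\mathcal E$, $k\geq 0$, and $f,\tau\in\mathbb Z_{\ge0}$. Every vehicle $i\in\mathcal V$ obeys $$x_i[k+1]=x_i[k]+Tv_i[k]+\tfrac{T^2}{2}u_i[k],\qquad v_i[k+1]=v_i[k]+Tu_i[k]\qquad(k\ge 0),$$ with arbitrary positions at times $k<0$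 as initial history. Put $p_i[k]=x_i[k]-kTr$, $q_i[k]=v_i[k]-r$. A set $\mathcal M$ of at most $f$ vehicles is malicious ($f$-total malicious model): they choose $u_i$ arbitrarily, and may send arbitrary positions to the vehicles that rely on communication; vehicles in a given (possibly empty) set measure true positions instead. Each normal vehicle $i\notin\mathcal M$ applies $$u_i[k]=\sum_{j\in\mathcal N_i\setminus I_i[k]}a_{ij}[k]\bigl(p_j[k-\tau_{ij}[k]]-p_i[k]-\delta_{ij}\bigr)-\alpha_iq_i[k],\qquad 0\le\tau_{ij}[k]\le\tau,$$ where $p_j$ is the position of $j$ as known to $i$, and $I_i[k]$ is the set of ignored neighbors given by the ADP-MSR algorithm. If $i$ makes an update at time $k$, then $I_i[k]$ consists of all neighbors with $p_j[k-\tau_{ij}[k]]-p_i[k]-\delta_{ij}\ge0$ if these are fewer than $f$, and otherwise of $f$ neighbors with the largest such values, together with, symmetrically, all neighbors with values $\le0$ if these are fewer than $f$, and otherwise $f$ neighbors with the smallest values. If $i$ does not make an update at time $k$, it keeps the position values of its neighbors and the ignored set of time $k-1$ (so that $\tau_{ij}[k]=\tau_{ij}[k-1]+1$). Update times and delays are otherwise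 arbitrary. The network achieves resilient coordinated movement if for every $\mathcal M$ with $|\mathcal M|\le f$ and every run as above, $x_j[k]-x_i[k]\to\delta_{ij}$ and $v_i[k]\to r$ as $k\to\infty$ for all $i,j\notin\mathcal M$. Theorem. (a) Suppose that for each $i$ there is $S_i$ with $\sum_{j\in\mathcal N_i}a_{ij}[k]\le S_i$ for all $k\ge0$ and $$2\sqrt{S_i}\;\le\;\alpha_i+\tfrac{T S_i}{2}\;<\;\tfrac2T.$$ If $\mathcal G$ is $(2f+1)$-robust, then the network achieves resilient coordinated movement, and at an exponential rate: there is $\rho\in(0,1)$ such that for every $\mathcal M$ and every run there is $C$ with $|x_j[k]-x_i[k]-\delta_{ij}|\le C\rho^k$ and $|v_i[k]-r|\le C\rho^k$ for all $i,j\notin\mathcal M$, $k\ge0$. (b) Conversely (without the condition on the gains), if the network achieves resilient coordinated movement, then $\mathcal G$ is $(f+1,f+1)$-robust. -/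

import Mathlib

open Filter Topology

noncomputable section

open Classical in
/-- The neighbours of `i`: the nodes `j` with an edge from `j` to `i`. -/
def inNeighbors {V : Type*} [Fintype V] (G : Digraph V) (i : V) : Finset V :=
  Finset.univ.filter (fun j => G.Adj j i)

open Classical in
/-- The nodes of `S` that have at least `r` incoming edges from outside of `S`. -/
def reachable {V : Type*} [Fintype V] (G : Digraph V) (r : ℕ) (S : Finset V) : Finset V :=
  S.filter (fun i => r ≤ (inNeighbors G i \ S).card)

/-- `(r, s)`-robustness of a digraph on `n = Fintype.card V` nodes. -/
def IsRobust {V : Type*} [Fintype V] (G : Digraph V) (r s : ℕ) : Prop :=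
  r < Fintype.card V ∧ s < Fintype.card V ∧
    ∀ V₁ V₂ : Finset V, V₁.Nonempty → V₂.Nonempty → Disjoint V₁ V₂ →
      reachable G r V₁ = V₁ ∨ reachable G r V₂ = V₂ ∨
        s ≤ (reachable G r V₁).card + (reachable G r V₂).card

/-- The data of a network of vehicles. -/
structure VehicleNetwork (V : Type*) where
  /-- the communication graph -/
  G : Digraph V
  /-- the sampling period -/
  T : ℝ
  /-- the desired velocity -/
  r : ℝ
  /-- `δ i j` is the desired position of `j` relative to `i` -/
  δ : V → V → ℝ
  /-- the velocity feedback gains -/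
  α : V → ℝ
  /-- `a k i j` is the weight at time `k` of the edge `(j, i)`, before any edge is ignored -/
  a : ℕ → V → V → ℝ
  /-- the bound for the communication delays -/
  τ : ℕ
  /-- the bound for the number of malicious vehicles, used in the filtering -/
  f : ℕ
  /-- the vehicles with an active sensing system, which measure true positions; all others
  trust what their neighbours broadcast -/
  active : Set V

/-- A run of the network. Time is `ℤ`, the initial time is `0`, and the values at negative times
are the initial history of the network. -/
structure NetworkRun (V : Type*) where
  /-- positions -/
  x : V → ℤ → ℝ
  /-- velocities -/
  v : V → ℤ → ℝ
  /-- control inputs -/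
  u : V → ℤ → ℝ
  /-- `seen i j k` is the position of `j` at time `k` as it is measured by, or sent to, `i` -/
  seen : V → V → ℤ → ℝ
  /-- the times at which a vehicle makes an update -/
  upd : V → Set ℤ
  /-- `delay i j k` is the age of the position value of `j` that `i` uses at time `k` -/
  delay : V → V → ℤ → ℕ
  /-- the neighbours of `i` whose edges `i` ignores at time `k` -/
  ignored : V → ℤ → Finset V

namespace NetworkRun

variable {V : Type*} (N : VehicleNetwork V) (e : NetworkRun V)

/-- The transformed position `p i k`, where `x i k = p i k + k T r`. -/
def p (i : V) (k : ℤ) : ℝ := e.x i k - k * N.T * N.r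

/-- The transformed velocity `q i k`, where `v i k = q i k + r`. -/
def q (i : V) (k : ℤ) : ℝ := e.v i k - N.r

/-- The transformed position of `j` at time `k` as seen by `i`. -/
def pSeen (i j : V) (k : ℤ) : ℝ := e.seen i j k - k * N.T * N.r

/-- The relative position value `p_j[k - τ_ij[k]] - p_i[k] - δ_ij` that `i` calculates. -/
def rel (i j : V) (k : ℤ) : ℝ :=
  e.pSeen N i j (k - (e.delay i j k : ℤ)) - e.p N i k - N.δ i j

end NetworkRun

open Classical in
/-- `H` is a set of neighbours (elements of `B`) ignored on the side of the large values of `d`: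
all those with `0 ≤ d j` if these are less than `f`, and else `f` ones with the largest values,
where ties are broken arbitrarily. -/
def IgnoresLargest {V : Type*} (f : ℕ) (B : Finset V) (d : V → ℝ) (H : Finset V) : Prop :=
  H ⊆ B ∧
    if (B.filter (fun j => 0 ≤ d j)).card < f then H = B.filter (fun j => 0 ≤ d j)
    else H.card = f ∧ ∀ j ∈ H, ∀ l ∈ B \ H, d l ≤ d j

open Classical in
/-- The filtering step: `S` consists of the neighbours ignored for their large values and of
those ignored for their small values (large values of `-d`). -/
def IgnoresExtremes {V : Type*} (f : ℕ) (B : Finset V) (d : V → ℝ) (S : Finset V) : Prop :=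
  ∃ H L : Finset V, IgnoresLargest f B d H ∧ IgnoresLargest f B (fun j => - d j) L ∧ S = H ∪ L

open Classical in
/-- `e` is a possible run of the network `N` when `M` is the set of malicious vehicles.
All vehicles obey the sampled double-integrator dynamics. Malicious vehicles choose their inputs
arbitrarily and send arbitrary positions to the vehicles that rely on communication. Normal vehicles
execute the filtering algorithm and apply the resulting control input. -/
structure IsRun {V : Type*} [Fintype V] (N : VehicleNetwork V) (M : Finset V)
    (e : NetworkRun V) : Prop where
  position : ∀ (i : V) (k : ℕ),
    e.x i (k + 1) = e.x i k + N.T * e.v i k + N.T ^ 2 / 2 * e.u i k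
  velocity : ∀ (i : V) (k : ℕ), e.v i (k + 1) = e.v i k + N.T * e.u i k
  truthful : ∀ (i j : V) (k : ℤ), j ∉ M ∨ i ∈ N.active → e.seen i j k = e.x j k
  delay_le : ∀ i ∉ M, ∀ j ∈ inNeighbors N.G i, ∀ k : ℤ, e.delay i j k ≤ N.τ
  /-- at an update the extreme values are filtered out -/
  update : ∀ i ∉ M, ∀ k ∈ e.upd i,
    IgnoresExtremes N.f (inNeighbors N.G i) (fun j => e.rel N i j k) (e.ignored i k)
  /-- otherwise the position values of the neighbours, which are one step older now, and the
  ignored edges remain as they were -/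
  hold : ∀ i ∉ M, ∀ k ∉ e.upd i, e.ignored i k = e.ignored i (k - 1) ∧
    ∀ j ∈ inNeighbors N.G i, e.delay i j k = e.delay i j (k - 1) + 1
  control : ∀ i ∉ M, ∀ k : ℕ,
    e.u i k = (∑ j ∈ inNeighbors N.G i \ e.ignored i k, N.a k i j * e.rel N i j k)
      - N.α i * e.q N i k

/-- Resilient coordinated movement under the `f`-total malicious model: for every set of at most
`f` malicious vehicles and every run. -/
def ResilientMovement {V : Type*} [Fintype V] (N : VehicleNetwork V) : Prop :=
  ∀ M : Finset V, M.card ≤ N.f → ∀ e : NetworkRun V, IsRun N M e →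
    (∀ i ∉ M, ∀ j ∉ M,
      Tendsto (fun k : ℕ => e.x j k - e.x i k) atTop (𝓝 (N.δ i j))) ∧
    ∀ i ∉ M, Tendsto (fun k : ℕ => e.v i k) atTop (𝓝 N.r)

/-- The convergence in resilient coordinated movement is exponential, with a rate `ρ` that is
common to all sets of malicious vehicles and all runs. -/
def ExponentialRate {V : Type*} [Fintype V] (N : VehicleNetwork V) : Prop :=
  ∃ ρ : ℝ, 0 < ρ ∧ ρ < 1 ∧
    ∀ M : Finset V, M.card ≤ N.f → ∀ e : NetworkRun V, IsRun N M e →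
      ∃ C : ℝ, ∀ k : ℕ,
        (∀ i ∉ M, ∀ j ∉ M, |e.x j k - e.x i k - N.δ i j| ≤ C * ρ ^ k) ∧
        ∀ i ∉ M, |e.v i k - N.r| ≤ C * ρ ^ k

/-- The standing assumptions on the data: positive sampling period and gains, relative positions
that fit together, and edge weights bounded away from zero. -/
def WellPosed {V : Type*} (N : VehicleNetwork V) : Prop :=
  0 < N.T ∧ (∀ i, 0 < N.α i) ∧ (∀ i j l, N.δ i j + N.δ j l = N.δ i l) ∧
    ∃ γ : ℝ, 0 < γ ∧ ∀ (k : ℕ) (i j : V), N.G.Adj j i → γ ≤ N.a k i j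

/-- The velocity gains fit the weights and the sampling period: with a bound `S i` for the total
weight at `i`, the recursion of the single vehicle `i` towards a fixed position is stable and
does not oscillate. -/
def GainCondition {V : Type*} [Fintype V] (N : VehicleNetwork V) : Prop :=
  ∀ i, ∃ S : ℝ, (∀ k : ℕ, ∑ j ∈ inNeighbors N.G i, N.a k i j ≤ S) ∧
    2 * √S ≤ N.α i + N.T * S / 2 ∧ N.α i + N.T * S / 2 < 2 / N.T

end

/-!
With a suitable time constant `c`, the dynamics of a vehicle in the coordinates `p` and `p + c * q`
has nonnegative coefficients. Hence, whenever all normal vehicles and the values they use are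
below a bound, a fixed fraction of every gap to that bound is inherited in one step. By reflection
the same holds for lower bounds. The filtering keeps every used value within the range of the recent
positions of the normal vehicles.

Consider the vehicles above and those below the midpoint of the current range. By robustness, as
long as both groups are nonempty, some member of one of them has `2 f + 1` neighbours outside
its group. The filtering lets a value outside the group pass, and that pulls the member away
from its extreme. So the groups lose their members one at a time, and within a fixed number of
steps the range contracts by a fixed factor.

Conversely, if robustness fails, there are two groups in which all normal vehicles have at most `f`
neighbours outside their own group. If each group starts in formation, but shifted against the other
one, then these neighbours are filtered out and the groups keep their distance forever.
-/

section TimeConstant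

/-- `c` is a time constant for a vehicle with velocity gain `α` and total weight at most `S` that is
controlled with sampling period `T`: in the coordinates `p` and `p + c * q` its recursion has
nonnegative coefficients. The two differences required to be positive are the coefficients
of `p + c * q`. -/
structure IsTimeConstant (T α S c : ℝ) : Prop where
  pos : 0 < c
  position_coeff_pos : 0 < T - T ^ 2 / 2 * α
  position_coeff_le : c * (T ^ 2 / 2 * S) + (T - T ^ 2 / 2 * α) ≤ c
  state_coeff_pos : 0 < T + c - T * (c + T / 2) * α
  state_coeff_le : c * (c + T / 2) * S + 1 ≤ (c + T / 2) * α

-- In units with `T = 1`, where `β = α + S / 2` and `d = c + 1 / 2`.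
lemma exists_normalized_timeConstant {β S : ℝ} (hβ₀ : 0 < β) (hβ₂ : β < 2)
    (hS₀ : 0 ≤ S) (hS : 4 * S ≤ β ^ 2) :
    ∃ d : ℝ, 1 / 2 < d ∧ 3 - β ≤ d * (2 - S) ∧ d * (2 * β - 2 - S) < 1 ∧
      S * d ^ 2 + 1 ≤ β * d := by
  rcases le_or_gt S (β - 1) with h | h
  · -- This `d` makes the second condition an equality, and then the fourth one factors.
    obtain ⟨y, rfl⟩ : ∃ y, β = 3 - y := ⟨3 - β, by ring⟩
    obtain ⟨x, rfl⟩ : ∃ x, S = 2 - x := ⟨2 - S, by ring⟩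
    have hx : 0 < x := by linarith
    have hfactor : (2 - x) * (y / x) ^ 2 + 1 - (3 - y) * (y / x) =
        (x - y) * (x - 2 * y) / x ^ 2 := by
      field_simp
      ring
    have hfactor_nonpos : (x - y) * (x - 2 * y) / x ^ 2 ≤ 0 :=
      div_nonpos_of_nonpos_of_nonneg
        (mul_nonpos_of_nonneg_of_nonpos (by linarith) (by linarith)) (sq_nonneg x)
    refine ⟨y / x, ?_, ?_, ?_, by linarith⟩
    · rw [div_lt_div_iff₀ two_pos hx]
      nlinarith
    · rw [sub_sub_cancel, sub_sub_cancel, div_mul_cancel₀ _ hx.ne']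
    · rw [div_mul_eq_mul_div, div_lt_one hx]
      nlinarith
  · refine ⟨2 / β, ?_, ?_, ?_, ?_⟩
    · rw [div_lt_div_iff₀ two_pos hβ₀]
      linarith
    · rw [div_mul_eq_mul_div, le_div_iff₀ hβ₀]
      nlinarith
    · rw [div_mul_eq_mul_div, div_lt_one hβ₀]
      linarith
    · rw [mul_div_cancel₀ _ hβ₀.ne', div_pow, mul_div_assoc', ← le_sub_iff_add_le,
        div_le_iff₀ (by positivity)]
      linarith

lemma exists_isTimeConstant {T α S : ℝ} (hT : 0 < T) (hα : 0 < α) (hS : 0 ≤ S)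
    (hstable : 2 * √S ≤ α + T * S / 2) (hperiod : α + T * S / 2 < 2 / T) :
    ∃ c : ℝ, IsTimeConstant T α S c := by
  have hβ : T * (α + T * S / 2) < 2 := by
    rwa [lt_div_iff₀' hT] at hperiod
  have hdiscr : 4 * S ≤ (α + T * S / 2) ^ 2 := by
    have := pow_le_pow_left₀ (by positivity) hstable 2
    rw [mul_pow, Real.sq_sqrt hS] at this
    linarith
  obtain ⟨d, hd, hp, hs, hs'⟩ := exists_normalized_timeConstant
    (β := T * (α + T * S / 2)) (S := T ^ 2 * S) (by positivity) hβ
    (by positivity) (by nlinarith [sq_nonneg T])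
  have hTS : 0 ≤ T * S := by positivity
  refine ⟨T * (d - 1 / 2), mul_pos hT (by linarith), ?_, ?_, ?_, ?_⟩
  · nlinarith
  · nlinarith
  · nlinarith
  · nlinarith

namespace IsTimeConstant

variable {T α S c p q u b W D : ℝ}

-- In the next two lemmas `W` is the sum of the weights and `D` is the weighted sum of the
-- distances of the used positions to the upper bound `b`.
lemma position_gap (hc : IsTimeConstant T α S c) (hW : W ≤ S) (hD : 0 ≤ D) (hp : p ≤ b)
    (hu : u = W * (b - p) - D - α * q) :
    (T - T ^ 2 / 2 * α) * (b - (p + c * q)) ≤ c * (b - (p + T * q + T ^ 2 / 2 * u)) := by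
  have hexpand : c * (b - (p + T * q + T ^ 2 / 2 * u)) =
      (c - c * (T ^ 2 / 2 * W) - (T - T ^ 2 / 2 * α)) * (b - p) + c * (T ^ 2 / 2) * D
        + (T - T ^ 2 / 2 * α) * (b - (p + c * q)) := by rw [hu]; ring
  have hc₀ := hc.pos
  have hcoeff : c * (T ^ 2 / 2 * W) ≤ c * (T ^ 2 / 2 * S) := by gcongr
  have hself : 0 ≤ (c - c * (T ^ 2 / 2 * W) - (T - T ^ 2 / 2 * α)) * (b - p) :=
    mul_nonneg (by linarith [hc.position_coeff_le]) (sub_nonneg.2 hp)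
  have hinput : 0 ≤ c * (T ^ 2 / 2) * D := by positivity
  linarith

lemma state_gap (hc : IsTimeConstant T α S c) (hT : 0 < T) (hW : W ≤ S) (hp : p ≤ b)
    (hu : u = W * (b - p) - D - α * q) :
    (T + c - T * (c + T / 2) * α) * (b - (p + c * q)) + c * (T * (c + T / 2) * D) ≤
      c * (b - (p + T * q + T ^ 2 / 2 * u + c * (q + T * u))) := by
  have hexpand : c * (b - (p + T * q + T ^ 2 / 2 * u + c * (q + T * u))) =
      T * ((c + T / 2) * α - 1 - c * (c + T / 2) * W) * (b - p) + c * (T * (c + T / 2) * D)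
        + (T + c - T * (c + T / 2) * α) * (b - (p + c * q)) := by rw [hu]; ring
  have hc₀ := hc.pos
  have hcoeff : c * (c + T / 2) * W ≤ c * (c + T / 2) * S := by gcongr
  have hself : 0 ≤ T * ((c + T / 2) * α - 1 - c * (c + T / 2) * W) * (b - p) :=
    mul_nonneg (mul_nonneg hT.le (by linarith [hc.state_coeff_le])) (sub_nonneg.2 hp)
  linarith

end IsTimeConstant

end TimeConstant

namespace VehicleNetwork

variable {V : Type*} [Fintype V] {N : VehicleNetwork V} {i : V}

/-- One step of vehicle `i` with retained neighbours `R` at positions `z` keeps a fraction `η` of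
every gap to a common upper bound `b`: the gap of the old extrapolated position `p + c * q` is
inherited by the new position and by the new extrapolated position, and the gap of every `z j`
by the latter. -/
def StepBound (N : VehicleNetwork V) (i : V) (c η : ℝ) : Prop :=
  ∀ (k : ℕ) (R : Finset V), R ⊆ inNeighbors N.G i → ∀ (z : V → ℝ) (p q u b : ℝ),
    u = ∑ j ∈ R, N.a k i j * (z j - p) - N.α i * q →
    p ≤ b → p + c * q ≤ b → (∀ j ∈ R, z j ≤ b) →
    p + N.T * q + N.T ^ 2 / 2 * u ≤ b - η * (b - (p + c * q)) ∧
    p + N.T * q + N.T ^ 2 / 2 * u + c * (q + N.T * u) ≤ b - η * (b - (p + c * q)) ∧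
    ∀ j ∈ R, p + N.T * q + N.T ^ 2 / 2 * u + c * (q + N.T * u) ≤ b - η * (b - z j)

lemma StepBound.mono {c η η' : ℝ} (h : N.StepBound i c η) (hη : η' ≤ η) :
    N.StepBound i c η' := by
  intro k R hR z p q u b hu hp hy hz
  have hweaken : ∀ x ≤ b, b - η * (b - x) ≤ b - η' * (b - x) := fun x hx =>
    sub_le_sub_left (mul_le_mul_of_nonneg_right hη (sub_nonneg.2 hx)) b
  obtain ⟨hp', hy', hz'⟩ := h k R hR z p q u b hu hp hy hz
  exact ⟨hp'.trans (hweaken _ hy), hy'.trans (hweaken _ hy),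
    fun j hj => (hz' j hj).trans (hweaken _ (hz j hj))⟩

lemma stepBound_of_isTimeConstant {S γ c η : ℝ} (hT : 0 < N.T) (hγ : 0 ≤ γ)
    (ha : ∀ k, ∀ j ∈ inNeighbors N.G i, γ ≤ N.a k i j)
    (hS : ∀ k, ∑ j ∈ inNeighbors N.G i, N.a k i j ≤ S) (hc : IsTimeConstant N.T (N.α i) S c)
    (hηp : η * c ≤ N.T - N.T ^ 2 / 2 * N.α i)
    (hηs : η * c ≤ N.T + c - N.T * (c + N.T / 2) * N.α i)
    (hηγ : η ≤ N.T * (c + N.T / 2) * γ) : N.StepBound i c η := by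
  intro k R hR z p q u b hu hp hy hz
  have ha₀ : ∀ j ∈ inNeighbors N.G i, 0 ≤ N.a k i j := fun j hj => hγ.trans (ha k j hj)
  have hW : ∑ j ∈ R, N.a k i j ≤ S :=
    (Finset.sum_le_sum_of_subset_of_nonneg hR fun j hj _ => ha₀ j hj).trans (hS k)
  have hterm : ∀ j ∈ R, 0 ≤ N.a k i j * (b - z j) := fun j hj =>
    mul_nonneg (ha₀ j (hR hj)) (sub_nonneg.2 (hz j hj))
  have hD : 0 ≤ ∑ j ∈ R, N.a k i j * (b - z j) := Finset.sum_nonneg hterm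
  replace hu : u = (∑ j ∈ R, N.a k i j) * (b - p) - ∑ j ∈ R, N.a k i j * (b - z j)
      - N.α i * q := by
    rw [hu, Finset.sum_mul, ← Finset.sum_sub_distrib]
    simp only [← mul_sub, sub_sub_sub_cancel_left]
  have hgap : 0 ≤ b - (p + c * q) := sub_nonneg.2 hy
  have hc₀ : 0 < c := hc.pos
  have hp' := hc.position_gap hW hD hp hu
  have hy' := hc.state_gap hT hW hp hu
  have hpull : 0 ≤ c * (N.T * (c + N.T / 2) * ∑ j ∈ R, N.a k i j * (b - z j)) := by positivity
  refine ⟨le_of_mul_le_mul_left ?_ hc₀, le_of_mul_le_mul_left ?_ hc₀, fun j hj => ?_⟩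
  · linarith [mul_le_mul_of_nonneg_right hηp hgap]
  · linarith [mul_le_mul_of_nonneg_right hηs hgap]
  · have hself := mul_nonneg hc.state_coeff_pos.le hgap
    have hzj : 0 ≤ b - z j := sub_nonneg.2 (hz j hj)
    have hweight : γ * (b - z j) ≤ ∑ l ∈ R, N.a k i l * (b - z l) :=
      (mul_le_mul_of_nonneg_right (ha k j (hR hj)) hzj).trans
        (Finset.single_le_sum hterm hj)
    calc p + N.T * q + N.T ^ 2 / 2 * u + c * (q + N.T * u)
        ≤ b - N.T * (c + N.T / 2) * ∑ l ∈ R, N.a k i l * (b - z l) :=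
          le_of_mul_le_mul_left (by linarith) hc₀
      _ ≤ b - N.T * (c + N.T / 2) * (γ * (b - z j)) := by gcongr
      _ = b - N.T * (c + N.T / 2) * γ * (b - z j) := by ring
      _ ≤ b - η * (b - z j) := by gcongr

lemma exists_stepBound_of_gain {S γ : ℝ} (hT : 0 < N.T) (hα : 0 < N.α i) (hγ : 0 < γ)
    (ha : ∀ k, ∀ j ∈ inNeighbors N.G i, γ ≤ N.a k i j)
    (hS : ∀ k, ∑ j ∈ inNeighbors N.G i, N.a k i j ≤ S)
    (hstable : 2 * √S ≤ N.α i + N.T * S / 2) (hperiod : N.α i + N.T * S / 2 < 2 / N.T) :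
    ∃ c η : ℝ, 0 < c ∧ 0 < η ∧ N.StepBound i c η := by
  have hS₀ : 0 ≤ S := (Finset.sum_nonneg fun j hj => hγ.le.trans (ha 0 j hj)).trans (hS 0)
  obtain ⟨c, hc⟩ := exists_isTimeConstant hT hα hS₀ hstable hperiod
  have hc₀ := hc.pos
  have hpos := hc.position_coeff_pos
  have hpos' := hc.state_coeff_pos
  refine ⟨c, min ((N.T - N.T ^ 2 / 2 * N.α i) / c)
    (min ((N.T + c - N.T * (c + N.T / 2) * N.α i) / c) (N.T * (c + N.T / 2) * γ)),
    hc₀, by positivity, stepBound_of_isTimeConstant hT hγ.le ha hS hc ?_ ?_ ?_⟩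
  · exact (le_div_iff₀ hc₀).1 (min_le_left _ _)
  · exact (le_div_iff₀ hc₀).1 ((min_le_right _ _).trans (min_le_left _ _))
  · exact (min_le_right _ _).trans (min_le_right _ _)

lemma exists_stepBound (hN : WellPosed N) (hgain : GainCondition N) :
    ∃ (c : V → ℝ) (η : ℝ), (∀ i, 0 < c i) ∧ 0 < η ∧ η ≤ 1 ∧ ∀ i, N.StepBound i (c i) η := by
  obtain ⟨hT, hα, -, γ, hγ, ha⟩ := hN
  choose S hS hstable hperiod using hgain
  choose c η' hc hη' hstep using fun i =>
    exists_stepBound_of_gain hT (hα i) hγ (fun k j hj => ha k i j (by simpa [inNeighbors] using hj))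
      (hS i) (hstable i) (hperiod i)
  obtain ⟨⟨η, hη⟩, hηle⟩ := Finite.exists_ge fun i => (⟨η' i, hη' i⟩ : Set.Ioi (0 : ℝ))
  exact ⟨c, min η 1, hc, lt_min hη one_pos, min_le_right _ _,
    fun i => (hstep i).mono ((min_le_left _ _).trans (hηle i))⟩

end VehicleNetwork

section Filtering

variable {V : Type*} {f : ℕ} {B H S M A : Finset V} {d d' : V → ℝ} {b : ℝ} {j l : V}

namespace IgnoresLargest

lemma congr (h : IgnoresLargest f B d H) (hd : ∀ j ∈ B, d j = d' j) :
    IgnoresLargest f B d' H := by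
  classical
  obtain ⟨hHB, h⟩ := h
  have hfilter : B.filter (fun j => 0 ≤ d j) = B.filter (fun j => 0 ≤ d' j) :=
    Finset.filter_congr fun j hj => by rw [hd j hj]
  rw [hfilter] at h
  refine ⟨hHB, ?_⟩
  split_ifs at h ⊢
  · exact h
  · refine ⟨h.1, fun j hj l hl => ?_⟩
    rw [← hd j (hHB hj), ← hd l (Finset.sdiff_subset hl)]
    exact h.2 j hj l hl

lemma card_le (h : IgnoresLargest f B d H) : H.card ≤ f := by
  obtain ⟨-, h⟩ := h
  split_ifs at h with hcard
  · exact h ▸ hcard.le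
  · exact h.1.le

lemma mem_of_card_lt (h : IgnoresLargest f B d H) (hcard : H.card < f) (hj : j ∈ B)
    (hd : 0 ≤ d j) : j ∈ H := by
  obtain ⟨-, h⟩ := h
  split_ifs at h
  · exact h ▸ Finset.mem_filter.2 ⟨hj, hd⟩
  · exact absurd h.1 hcard.ne

lemma le_of_mem (h : IgnoresLargest f B d H) (hj : j ∈ B) (hjH : j ∉ H) (hl : l ∈ H) :
    d j ≤ d l := by
  classical
  obtain ⟨-, h⟩ := h
  split_ifs at h
  · subst h
    simp only [Finset.mem_filter, not_and, not_le] at hjH hl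
    exact (hjH hj).le.trans hl.2
  · exact h.2 l hl j (by simp [hj, hjH])

lemma le_of_forall_le (h : IgnoresLargest f B d H) (hM : M.card ≤ f) (hb : 0 ≤ b)
    (hB : ∀ j ∈ B, j ∉ M → d j ≤ b) (hj : j ∈ B) (hjH : j ∉ H) : d j ≤ b := by
  classical
  by_contra! hlt
  -- Otherwise `j` and all of `H` are malicious, so `H` has room for `j`.
  have hsub : insert j H ⊆ M := by
    intro l hl
    by_contra hlM
    rcases Finset.mem_insert.1 hl with rfl | hl
    · exact (hB _ hj hlM).not_gt hlt
    · exact (hB l (h.1 hl) hlM).not_gt (hlt.trans_le (h.le_of_mem hj hjH hl))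
  have hcard := Finset.card_le_card hsub
  rw [Finset.card_insert_of_notMem hjH] at hcard
  exact hjH (h.mem_of_card_lt (hcard.trans hM) hj (hb.trans hlt.le))

end IgnoresLargest

lemma exists_subset_card_eq_forall_le {α β : Type*} [LinearOrder β] (s : Finset α) (g : α → β)
    {n : ℕ} (hn : n ≤ s.card) :
    ∃ t ⊆ s, t.card = n ∧ ∀ x ∈ t, ∀ y ∈ s, y ∉ t → g y ≤ g x := by
  classical
  induction n with
  | zero => exact ⟨∅, by simp, by simp, by simp⟩
  | succ n ih =>
    obtain ⟨t, hts, htn, ht⟩ := ih (by omega)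
    have hne : (s \ t).Nonempty :=
      Finset.sdiff_nonempty.2 fun hst => by
        have := Finset.card_le_card hst
        omega
    obtain ⟨m, hm, hmax⟩ := (s \ t).exists_max_image g hne
    obtain ⟨hms, hmt⟩ := Finset.mem_sdiff.1 hm
    refine ⟨insert m t, Finset.insert_subset hms hts,
      by rw [Finset.card_insert_of_notMem hmt, htn], fun x hx y hys hyt => ?_⟩
    have hyt' : y ∉ t := fun h => hyt (Finset.mem_insert_of_mem h)
    rcases Finset.mem_insert.1 hx with rfl | hx
    · exact hmax y (Finset.mem_sdiff.2 ⟨hys, hyt'⟩)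
    · exact ht x hx y hys hyt'

lemma exists_ignoresLargest (f : ℕ) (B : Finset V) (d : V → ℝ) :
    ∃ H, IgnoresLargest f B d H := by
  classical
  by_cases h : (B.filter (fun j => 0 ≤ d j)).card < f
  · refine ⟨B.filter (fun j => 0 ≤ d j), Finset.filter_subset _ _, ?_⟩
    rw [if_pos (by convert h)]
  · obtain ⟨H, hHB, hcard, hH⟩ :=
      exists_subset_card_eq_forall_le B d ((not_lt.1 h).trans (Finset.card_filter_le _ _))
    refine ⟨H, hHB, ?_⟩
    rw [if_neg (by convert h)]
    refine ⟨hcard, fun j hj l hl => ?_⟩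
    simp only [Finset.mem_sdiff] at hl
    exact hH j hj l hl.1 hl.2

namespace IgnoresExtremes

lemma neg (h : IgnoresExtremes f B d S) : IgnoresExtremes f B (fun j => -d j) S := by
  classical
  obtain ⟨H, L, hH, hL, rfl⟩ := h
  exact ⟨L, H, hL, by simpa only [neg_neg] using hH, Finset.union_comm _ _⟩

lemma congr (h : IgnoresExtremes f B d S) (hd : ∀ j ∈ B, d j = d' j) :
    IgnoresExtremes f B d' S := by
  obtain ⟨H, L, hH, hL, hS⟩ := h
  exact ⟨H, L, hH.congr hd, hL.congr fun j hj => congrArg Neg.neg (hd j hj), hS⟩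

lemma le_of_forall_le (h : IgnoresExtremes f B d S) (hM : M.card ≤ f) (hb : 0 ≤ b)
    (hB : ∀ j ∈ B, j ∉ M → d j ≤ b) (hj : j ∈ B) (hjS : j ∉ S) : d j ≤ b := by
  classical
  obtain ⟨H, L, hH, -, rfl⟩ := h
  rw [Finset.mem_union, not_or] at hjS
  exact hH.le_of_forall_le hM hb hB hj hjS.1

lemma eq_zero (h : IgnoresExtremes f B d S) (hM : M.card ≤ f)
    (hB : ∀ j ∈ B, j ∉ M → d j = 0) (hj : j ∈ B) (hjS : j ∉ S) : d j = 0 :=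
  le_antisymm (h.le_of_forall_le hM le_rfl (fun l hl hlM => (hB l hl hlM).le) hj hjS)
    (neg_nonpos.1 <| h.neg.le_of_forall_le hM le_rfl
      (fun l hl hlM => (neg_eq_zero.2 (hB l hl hlM)).le) hj hjS)

lemma exists_le (h : IgnoresExtremes f B d S) (hM : M.card ≤ f) (hA : A ⊆ B)
    (hcard : 2 * f + 1 ≤ A.card) (hb : ∀ j ∈ A, j ∉ M → d j ≤ b) :
    ∃ j ∈ B, j ∉ S ∧ d j ≤ b := by
  classical
  obtain ⟨H, L, hH, hL, rfl⟩ := h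
  have hHc := hH.card_le
  have hLc := hL.card_le
  obtain ⟨j, hj⟩ : (A \ (H ∪ L)).Nonempty := by
    have := Finset.le_card_sdiff (H ∪ L) A
    have := Finset.card_union_le H L
    exact Finset.card_pos.1 (by omega)
  obtain ⟨l, hl⟩ : ((A \ M) \ L).Nonempty := by
    have := Finset.le_card_sdiff L (A \ M)
    have := Finset.le_card_sdiff M A
    exact Finset.card_pos.1 (by omega)
  simp only [Finset.mem_sdiff, Finset.mem_union, not_or] at hj hl ⊢
  by_cases hlH : l ∈ H
  · exact ⟨j, hA hj.1, hj.2,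
      (hH.le_of_mem (hA hj.1) hj.2.1 hlH).trans (hb l hl.1.1 hl.1.2)⟩
  · exact ⟨l, hA hl.1.1, ⟨hlH, hl.2⟩, hb l hl.1.1 hl.1.2⟩

end IgnoresExtremes

lemma exists_ignoresExtremes (f : ℕ) (B : Finset V) (d : V → ℝ) :
    ∃ S, IgnoresExtremes f B d S := by
  obtain ⟨H, hH⟩ := exists_ignoresLargest f B d
  obtain ⟨L, hL⟩ := exists_ignoresLargest f B fun j => -d j
  exact ⟨_, H, L, hH, hL, rfl⟩

end Filtering

lemma exists_pow_div_le_mul_pow {θ : ℝ} (hθ₀ : 0 < θ) (hθ₁ : θ < 1) {L : ℕ} (hL : L ≠ 0) :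
    ∃ ρ : ℝ, 0 < ρ ∧ ρ < 1 ∧ ∀ k : ℕ, θ ^ (k / L) ≤ θ⁻¹ * ρ ^ k := by
  obtain ⟨ρ, hρ₀, hρL⟩ : ∃ ρ : ℝ, 0 < ρ ∧ ρ ^ L = θ :=
    ⟨θ ^ (L : ℝ)⁻¹, Real.rpow_pos_of_pos hθ₀ _, Real.rpow_inv_natCast_pow hθ₀.le hL⟩
  have hρ₁ : ρ < 1 := (pow_lt_one_iff_of_nonneg hρ₀.le hL).1 (hρL ▸ hθ₁)
  refine ⟨ρ, hρ₀, hρ₁, fun k => ?_⟩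
  rw [le_inv_mul_iff₀ hθ₀, ← pow_succ', ← hρL, ← pow_mul]
  exact pow_le_pow_of_le_one hρ₀.le hρ₁.le (Nat.lt_mul_div_succ k (Nat.pos_of_ne_zero hL)).le

section Graph

variable {V : Type*} [Fintype V] {G : Digraph V} {r : ℕ} {A A₁ A₂ : Finset V} {i : V}

open Classical in
lemma mem_reachable : i ∈ reachable G r A ↔ i ∈ A ∧ r ≤ (inNeighbors G i \ A).card :=
  Finset.mem_filter

lemma IsRobust.reachable_nonempty_or (h : IsRobust G r 1) (hA₁ : A₁.Nonempty)
    (hA₂ : A₂.Nonempty) (hdisj : Disjoint A₁ A₂) :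
    (reachable G r A₁).Nonempty ∨ (reachable G r A₂).Nonempty := by
  rcases h.2.2 A₁ A₂ hA₁ hA₂ hdisj with h | h | h
  · exact .inl (h.symm ▸ hA₁)
  · exact .inr (h.symm ▸ hA₂)
  · simp only [← Finset.card_pos]
    omega

end Graph

section Contraction

variable {V : Type*}

/-- At time `k`, the last `τ + 1` positions `P` and the state `Y` of every normal vehicle lie
in `I`. Half-lines `I` describe the one-sided bounds that the dynamics preserve. -/
def Confined (M : Finset V) (τ : ℕ) (P : V → ℤ → ℝ) (Y : V → ℕ → ℝ) (I : Set ℝ) (k : ℕ) : Prop :=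
  ∀ i ∉ M, (∀ l ∈ Set.Icc ((k : ℤ) - τ) k, P i l ∈ I) ∧ Y i k ∈ I

/-- At time `k`, the state of every normal vehicle outside of `A` has distance at least `ε` to the
upper bound `b`. -/
def GapOutside (M A : Finset V) (Y : V → ℕ → ℝ) (b ε : ℝ) (k : ℕ) : Prop :=
  ∀ i ∉ M, i ∉ A → Y i k ≤ b - ε

/-- As long as the normal vehicles stay below a bound `b`, a fraction `η` of the distance of a state
to `b` is inherited in one step by the position and the state of the same vehicle, and a
fraction `η` of the distance of the recent positions of at least `r` neighbours is inherited by
the state. -/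
structure GapPropagation [Fintype V] (G : Digraph V) (M : Finset V) (r τ : ℕ) (η : ℝ)
    (P : V → ℤ → ℝ) (Y : V → ℕ → ℝ) : Prop where
  rate_pos : 0 < η
  rate_le_one : η ≤ 1
  position_le : ∀ {k : ℕ} {b ε : ℝ} {i : V}, Confined M τ P Y (Set.Iic b) k → i ∉ M →
    Y i k ≤ b - ε → P i (k + 1 : ℕ) ≤ b - η * ε
  state_le : ∀ {k : ℕ} {b ε : ℝ} {i : V}, Confined M τ P Y (Set.Iic b) k → i ∉ M →
    Y i k ≤ b - ε → Y i (k + 1) ≤ b - η * ε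
  state_le_of_neighbors : ∀ {k : ℕ} {b ε : ℝ} {i : V} {A : Finset V},
    Confined M τ P Y (Set.Iic b) k → i ∉ M → A ⊆ inNeighbors G i → r ≤ A.card →
    (∀ j ∈ A, j ∉ M → ∀ l ∈ Set.Icc ((k : ℤ) - τ) k, P j l ≤ b - ε) →
    Y i (k + 1) ≤ b - η * ε

section Confined

variable {M : Finset V} {τ : ℕ} {P : V → ℤ → ℝ} {Y : V → ℕ → ℝ} {m b : ℝ} {k : ℕ}

lemma confined_Icc_iff : Confined M τ P Y (Set.Icc m b) k ↔
    Confined M τ P Y (Set.Iic b) k ∧ Confined M τ (-P) (-Y) (Set.Iic (-m)) k := by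
  simp only [Confined, Set.mem_Icc (a := m), Set.mem_Iic, Pi.neg_apply, neg_le_neg_iff]
  grind

lemma exists_confined_Icc [Finite V] (M : Finset V) (τ : ℕ) (P : V → ℤ → ℝ) (Y : V → ℕ → ℝ)
    (k : ℕ) : ∃ D > 0, Confined M τ P Y (Set.Icc (-D) D) k := by
  have hfinite : (⋃ i, P i '' Set.Icc ((k : ℤ) - τ) k ∪ {Y i k}).Finite :=
    Set.finite_iUnion fun i => ((Set.finite_Icc _ _).image _).union (Set.finite_singleton _)
  obtain ⟨D, hD₀, hD⟩ := hfinite.isBounded.subset_closedBall_lt 0 0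
  rw [Real.closedBall_eq_Icc, zero_sub, zero_add] at hD
  refine ⟨D, hD₀, fun i _ => ⟨fun l hl => hD (Set.mem_iUnion.2 ⟨i, .inl ⟨l, hl, rfl⟩⟩),
    hD (Set.mem_iUnion.2 ⟨i, .inr rfl⟩)⟩⟩

end Confined

variable [Fintype V] {G : Digraph V} {M : Finset V} {r τ : ℕ} {η : ℝ}

namespace GapPropagation

variable {P : V → ℤ → ℝ} {Y : V → ℕ → ℝ} {A : Finset V} {b ε : ℝ} {k : ℕ} {i : V}

lemma confined_add (h : GapPropagation G M r τ η P Y) (hb : Confined M τ P Y (Set.Iic b) k)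
    (n : ℕ) : Confined M τ P Y (Set.Iic b) (k + n) := by
  induction n with
  | zero => exact hb
  | succ n ih =>
    intro i hi
    have hgap : Y i (k + n) ≤ b - 0 := by simpa using (ih i hi).2
    refine ⟨fun l hl => ?_, by simpa [add_assoc] using h.state_le ih hi hgap⟩
    rcases hl.2.lt_or_eq with hlt | rfl
    · exact (ih i hi).1 l ⟨by grind, by grind⟩
    · simpa [add_assoc] using h.position_le ih hi hgap

lemma state_add_le (h : GapPropagation G M r τ η P Y) (hb : Confined M τ P Y (Set.Iic b) k)
    (hi : i ∉ M) (hgap : Y i k ≤ b - ε) (n : ℕ) : Y i (k + n) ≤ b - η ^ n * ε := by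
  induction n with
  | zero => simpa using hgap
  | succ n ih =>
    rw [pow_succ', mul_assoc]
    exact h.state_le (h.confined_add hb n) hi ih

lemma position_le_of_mem_window (h : GapPropagation G M r τ η P Y)
    (hb : Confined M τ P Y (Set.Iic b) k) (hi : i ∉ M) (hε : 0 ≤ ε) (hgap : Y i k ≤ b - ε) {l : ℤ}
    (hl : l ∈ Set.Icc (((k + (τ + 1) : ℕ) : ℤ) - τ) (k + (τ + 1) : ℕ)) :
    P i l ≤ b - η ^ (τ + 1) * ε := by
  obtain ⟨n, hn, rfl⟩ : ∃ n ≤ τ, l = (k + n + 1 : ℕ) := by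
    obtain ⟨hl₁, hl₂⟩ := hl
    exact ⟨(l - k - 1).toNat, by omega, by omega⟩
  have hpow : η ^ (τ + 1) ≤ η ^ (n + 1) :=
    pow_le_pow_of_le_one h.rate_pos.le h.rate_le_one (by omega)
  calc P i (k + n + 1 : ℕ) ≤ b - η * (η ^ n * ε) :=
        h.position_le (h.confined_add hb n) hi (h.state_add_le hb hi hgap n)
    _ = b - η ^ (n + 1) * ε := by ring
    _ ≤ b - η ^ (τ + 1) * ε := by gcongr

lemma confined_of_gapOutside_empty (h : GapPropagation G M r τ η P Y)
    (hb : Confined M τ P Y (Set.Iic b) k) (hε : 0 ≤ ε) (hgap : GapOutside M ∅ Y b ε k) :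
    Confined M τ P Y (Set.Iic (b - η ^ (τ + 1) * ε)) (k + (τ + 1)) := fun i hi =>
  have hgap_i := hgap i hi (Finset.notMem_empty i)
  ⟨fun _ hl => h.position_le_of_mem_window hb hi hε hgap_i hl, h.state_add_le hb hi hgap_i _⟩

lemma gapOutside_add (h : GapPropagation G M r τ η P Y)
    (hb : Confined M τ P Y (Set.Iic b) k) (hgap : GapOutside M A Y b ε k) (n : ℕ) :
    GapOutside M A Y b (η ^ n * ε) (k + n) := fun i hi hiA =>
  h.state_add_le hb hi (hgap i hi hiA) n

lemma exists_ssubset_gapOutside (h : GapPropagation G M r τ η P Y)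
    (hb : Confined M τ P Y (Set.Iic b) k) (hε : 0 ≤ ε) (hgap : GapOutside M A Y b ε k)
    (hA : (reachable G r A).Nonempty) :
    ∃ A' ⊂ A, GapOutside M A' Y b (η ^ (τ + 2) * ε) (k + (τ + 2)) := by
  classical
  obtain ⟨i, hi⟩ := hA
  obtain ⟨hiA, hcard⟩ := mem_reachable.1 hi
  refine ⟨A.erase i, Finset.erase_ssubset hiA, fun j hj hjA => ?_⟩
  by_cases hji : j = i
  · subst hji
    rw [pow_succ', mul_assoc]
    exact h.state_le_of_neighbors (h.confined_add hb (τ + 1)) hj Finset.sdiff_subset hcard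
      fun l hl hlM s hs => h.position_le_of_mem_window hb hlM hε
        (hgap l hlM (Finset.mem_sdiff.1 hl).2) hs
  · exact h.state_add_le hb hj (hgap j hj fun hj => hjA (Finset.mem_erase.2 ⟨hji, hj⟩)) _

end GapPropagation

/-- The number of steps in which the spread of `n` vehicles with delay bound `τ` is guaranteed to
contract: `τ + 2` steps for every vehicle that leaves an extreme group, and `τ + 1` steps until
the positions from before are out of date. -/
def contractionPeriod (n τ : ℕ) : ℕ := n * (τ + 2) + (τ + 1)

section TwoGroups

variable {P₁ P₂ : V → ℤ → ℝ} {Y₁ Y₂ : V → ℕ → ℝ} {A₁ A₂ : Finset V} {b₁ b₂ ε : ℝ} {k : ℕ}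

lemma gapOutside_empty_or (hG : IsRobust G r 1) (h₁ : GapPropagation G M r τ η P₁ Y₁)
    (h₂ : GapPropagation G M r τ η P₂ Y₂) (hb₁ : Confined M τ P₁ Y₁ (Set.Iic b₁) k)
    (hb₂ : Confined M τ P₂ Y₂ (Set.Iic b₂) k) (hε : 0 ≤ ε) (hdisj : Disjoint A₁ A₂)
    (hgap₁ : GapOutside M A₁ Y₁ b₁ ε k) (hgap₂ : GapOutside M A₂ Y₂ b₂ ε k)
    {n : ℕ} (hn : A₁.card + A₂.card ≤ n) :
    GapOutside M ∅ Y₁ b₁ (η ^ (n * (τ + 2)) * ε) (k + n * (τ + 2)) ∨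
      GapOutside M ∅ Y₂ b₂ (η ^ (n * (τ + 2)) * ε) (k + n * (τ + 2)) := by
  induction n generalizing k ε A₁ A₂ with
  | zero =>
    obtain rfl : A₁ = ∅ := Finset.card_eq_zero.1 (by omega)
    exact .inl (by simpa using hgap₁)
  | succ n ih =>
    rcases A₁.eq_empty_or_nonempty with rfl | hne₁
    · exact .inl (h₁.gapOutside_add hb₁ hgap₁ _)
    rcases A₂.eq_empty_or_nonempty with rfl | hne₂
    · exact .inr (h₂.gapOutside_add hb₂ hgap₂ _)
    have htime : k + (n + 1) * (τ + 2) = k + (τ + 2) + n * (τ + 2) := by ring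
    have hrate : η ^ ((n + 1) * (τ + 2)) * ε = η ^ (n * (τ + 2)) * (η ^ (τ + 2) * ε) := by ring
    have hε' : 0 ≤ η ^ (τ + 2) * ε := mul_nonneg (pow_nonneg h₁.rate_pos.le _) hε
    have hb₁' := h₁.confined_add hb₁ (τ + 2)
    have hb₂' := h₂.confined_add hb₂ (τ + 2)
    rw [htime, hrate]
    rcases hG.reachable_nonempty_or hne₁ hne₂ hdisj with hr | hr
    · obtain ⟨A', hA', hgap'⟩ := h₁.exists_ssubset_gapOutside hb₁ hε hgap₁ hr
      exact ih hb₁' hb₂' hε' (hdisj.mono_left hA'.subset) hgap'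
        (h₂.gapOutside_add hb₂ hgap₂ _) (by have := Finset.card_lt_card hA'; omega)
    · obtain ⟨A', hA', hgap'⟩ := h₂.exists_ssubset_gapOutside hb₂ hε hgap₂ hr
      exact ih hb₁' hb₂' hε' (hdisj.mono_right hA'.subset)
        (h₁.gapOutside_add hb₁ hgap₁ _) hgap' (by have := Finset.card_lt_card hA'; omega)

lemma confined_or (hG : IsRobust G r 1) (h₁ : GapPropagation G M r τ η P₁ Y₁)
    (h₂ : GapPropagation G M r τ η P₂ Y₂) (hb₁ : Confined M τ P₁ Y₁ (Set.Iic b₁) k)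
    (hb₂ : Confined M τ P₂ Y₂ (Set.Iic b₂) k) (hε : 0 ≤ ε) (hdisj : Disjoint A₁ A₂)
    (hgap₁ : GapOutside M A₁ Y₁ b₁ ε k) (hgap₂ : GapOutside M A₂ Y₂ b₂ ε k)
    {L : ℕ} (hL : L = contractionPeriod (Fintype.card V) τ) :
    Confined M τ P₁ Y₁ (Set.Iic (b₁ - η ^ L * ε)) (k + L) ∨
      Confined M τ P₂ Y₂ (Set.Iic (b₂ - η ^ L * ε)) (k + L) := by
  classical
  have hcard : A₁.card + A₂.card ≤ Fintype.card V :=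
    Finset.card_union_of_disjoint hdisj ▸ Finset.card_le_univ _
  have hrate : η ^ L = η ^ (τ + 1) * η ^ (Fintype.card V * (τ + 2)) := by
    rw [hL, contractionPeriod, ← pow_add, add_comm]
  have hε' : 0 ≤ η ^ (Fintype.card V * (τ + 2)) * ε :=
    mul_nonneg (pow_nonneg h₁.rate_pos.le _) hε
  rw [hrate, mul_assoc, hL, contractionPeriod, ← add_assoc]
  exact (gapOutside_empty_or hG h₁ h₂ hb₁ hb₂ hε hdisj hgap₁ hgap₂ hcard).imp
    (h₁.confined_of_gapOutside_empty (h₁.confined_add hb₁ _) hε')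
    (h₂.confined_of_gapOutside_empty (h₂.confined_add hb₂ _) hε')

end TwoGroups

section TwoSided

variable {P : V → ℤ → ℝ} {Y : V → ℕ → ℝ} {L : ℕ} {m b : ℝ} {k : ℕ}

lemma exists_confined_Icc_add (hG : IsRobust G r 1) (h : GapPropagation G M r τ η P Y)
    (h' : GapPropagation G M r τ η (-P) (-Y)) (hL : L = contractionPeriod (Fintype.card V) τ)
    (hmb : m ≤ b) (hc : Confined M τ P Y (Set.Icc m b) k) :
    ∃ m' b' : ℝ, m' ≤ b' ∧ b' - m' = (1 - η ^ L / 2) * (b - m) ∧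
      Confined M τ P Y (Set.Icc m' b') (k + L) := by
  have hηL : η ^ L ≤ 1 := pow_le_one₀ h.rate_pos.le h.rate_le_one
  have hspread : 0 ≤ (1 - η ^ L / 2) * (b - m) := mul_nonneg (by linarith) (by linarith)
  rw [confined_Icc_iff] at hc
  -- The two extreme groups are the vehicles above and below the midpoint of `[m, b]`.
  have hgap : GapOutside M ({i | b - (b - m) / 2 < Y i k} : Finset V) Y b ((b - m) / 2) k :=
    fun i _ hi => by simpa using hi
  have hgap' : GapOutside M ({i | ¬ b - (b - m) / 2 < Y i k} : Finset V) (-Y) (-m)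
      ((b - m) / 2) k := fun i _ hi => by
    simp only [Finset.mem_filter_univ, not_not] at hi
    simp only [Pi.neg_apply]
    linarith
  rcases confined_or hG h h' hc.1 hc.2 (by linarith) (Finset.disjoint_filter_filter_not _ _ _)
    hgap hgap' hL with hb | hm
  · refine ⟨m, b - η ^ L * ((b - m) / 2), by linarith, by ring, ?_⟩
    exact confined_Icc_iff.2 ⟨hb, h'.confined_add hc.2 L⟩
  · refine ⟨m + η ^ L * ((b - m) / 2), b, by linarith, by ring, ?_⟩
    exact confined_Icc_iff.2 ⟨h.confined_add hc.1 L, by rwa [neg_add']⟩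

lemma exists_confined_Icc_of_isRobust (hG : IsRobust G r 1) (h : GapPropagation G M r τ η P Y)
    (h' : GapPropagation G M r τ η (-P) (-Y)) (hL : L = contractionPeriod (Fintype.card V) τ) :
    ∃ w ≥ 0, ∀ k, ∃ m b : ℝ, b - m = (1 - η ^ L / 2) ^ (k / L) * w ∧
      Confined M τ P Y (Set.Icc m b) k := by
  obtain ⟨D, hD₀, hD⟩ := exists_confined_Icc M τ P Y 0
  have hperiods : ∀ n, ∃ m b : ℝ, m ≤ b ∧ b - m = (1 - η ^ L / 2) ^ n * (2 * D) ∧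
      Confined M τ P Y (Set.Icc m b) (L * n) := by
    intro n
    induction n with
    | zero => exact ⟨-D, D, by linarith, by ring, hD⟩
    | succ n ih =>
      obtain ⟨m, b, hmb, hwidth, hc⟩ := ih
      obtain ⟨m', b', hmb', hwidth', hc'⟩ := exists_confined_Icc_add hG h h' hL hmb hc
      exact ⟨m', b', hmb', by rw [hwidth', hwidth]; ring, hc'⟩
  refine ⟨2 * D, by positivity, fun k => ?_⟩
  obtain ⟨m, b, -, hwidth, hc⟩ := hperiods (k / L)
  rw [confined_Icc_iff] at hc
  refine ⟨m, b, hwidth, confined_Icc_iff.2 ?_⟩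
  rw [← Nat.div_add_mod k L]
  exact ⟨h.confined_add hc.1 _, h'.confined_add hc.2 _⟩

end TwoSided

end Contraction

lemma exists_eq_sub_of_cocycle {V A : Type*} [AddCommGroup A] (δ : V → V → A)
    (hδ : ∀ i j l, δ i j + δ j l = δ i l) : ∃ d : V → A, ∀ i j, δ i j = d j - d i := by
  rcases isEmpty_or_nonempty V with hV | ⟨⟨o⟩⟩
  · exact ⟨0, fun i => isEmptyElim i⟩
  · exact ⟨δ o, fun i j => eq_sub_of_add_eq' (hδ o i j)⟩

namespace NetworkRun

variable {V : Type*} (N : VehicleNetwork V) (e : NetworkRun V) (d : V → ℝ)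

/-- The deviation of vehicle `i` from its place in the formation with desired positions `d`, which
moves with the desired velocity. -/
def deviation (i : V) (k : ℤ) : ℝ := e.p N i k - d i

/-- The deviation of vehicle `j` that vehicle `i` uses at time `k`. -/
def usedDeviation (i j : V) (k : ℤ) : ℝ := e.pSeen N i j (k - (e.delay i j k : ℤ)) - d j

/-- The deviation of vehicle `i` extrapolated with its velocity over the time `c i`. It is indexed
by natural numbers since velocities before the initial time play no role. -/
def extrapolation (c : V → ℝ) (i : V) (k : ℕ) : ℝ := e.deviation N d i k + c i * e.q N i k

/-- The reflected run, in which all positions and velocities change their signs. It exchanges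
upper and lower bounds. -/
def mirror : NetworkRun V where
  x i k := -e.x i k
  v i k := -e.v i k
  u i k := -e.u i k
  seen i j k := -e.seen i j k
  upd := e.upd
  delay := e.delay
  ignored := e.ignored

end NetworkRun

/-- The network whose runs are the reflected runs of `N`. -/
def VehicleNetwork.mirror {V : Type*} (N : VehicleNetwork V) : VehicleNetwork V where
  __ := N
  r := -N.r
  δ i j := -N.δ i j

namespace NetworkRun

variable {V : Type*} {N : VehicleNetwork V} {e : NetworkRun V} {d : V → ℝ}

lemma rel_eq (hd : ∀ i j, N.δ i j = d j - d i) (i j : V) (k : ℤ) :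
    e.rel N i j k = e.usedDeviation N d i j k - e.deviation N d i k := by
  rw [rel, usedDeviation, deviation, hd]
  ring

lemma rel_mirror (i j : V) (k : ℤ) : e.mirror.rel N.mirror i j k = -e.rel N i j k := by
  simp only [rel, pSeen, p, mirror, VehicleNetwork.mirror]
  ring

lemma q_mirror (i : V) (k : ℤ) : e.mirror.q N.mirror i k = -e.q N i k := by
  simp only [q, mirror, VehicleNetwork.mirror]
  ring

lemma deviation_mirror : e.mirror.deviation N.mirror (-d) = -e.deviation N d := by
  ext i k
  simp only [deviation, p, mirror, VehicleNetwork.mirror, Pi.neg_apply]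
  ring

lemma extrapolation_mirror (c : V → ℝ) :
    e.mirror.extrapolation N.mirror (-d) c = -e.extrapolation N d c := by
  ext i k
  simp only [extrapolation, deviation_mirror, q_mirror, Pi.neg_apply]
  ring

end NetworkRun

namespace IsRun

variable {V : Type*} [Fintype V] {N : VehicleNetwork V} {M : Finset V} {e : NetworkRun V}
  {d c : V → ℝ} {η b : ℝ} {i j : V}

lemma mirror (h : IsRun N M e) : IsRun N.mirror M e.mirror where
  position i k := by
    simp only [NetworkRun.mirror, VehicleNetwork.mirror, h.position i k]
    ring
  velocity i k := by
    simp only [NetworkRun.mirror, VehicleNetwork.mirror, h.velocity i k]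
    ring
  truthful i j k hij := congrArg Neg.neg (h.truthful i j k hij)
  delay_le := h.delay_le
  update i hi k hk := (h.update i hi k hk).neg.congr fun j _ => (NetworkRun.rel_mirror i j k).symm
  hold := h.hold
  control i hi k := by
    simp only [NetworkRun.rel_mirror, NetworkRun.q_mirror, mul_neg, Finset.sum_neg_distrib]
    simp only [NetworkRun.mirror, VehicleNetwork.mirror, h.control i hi k]
    ring

lemma hold_of_forall_notMem (h : IsRun N M e) (hi : i ∉ M) {k : ℤ} {n : ℕ}
    (hn : ∀ m < n, k - m ∉ e.upd i) : e.ignored i k = e.ignored i (k - n) ∧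
      ∀ j ∈ inNeighbors N.G i, e.delay i j k = e.delay i j (k - n) + n := by
  induction n with
  | zero => simp
  | succ n ih =>
    obtain ⟨hignored, hdelay⟩ := ih fun m hm => hn m (by omega)
    obtain ⟨hignored', hdelay'⟩ := h.hold i hi (k - n) (hn n (by omega))
    have htime : k - (n + 1 : ℕ) = k - n - 1 := by push_cast; ring
    rw [htime]
    refine ⟨hignored.trans hignored', fun j hj => ?_⟩
    rw [hdelay j hj, hdelay' j hj]
    ring

lemma exists_update (h : IsRun N M e) (hi : i ∉ M) (hne : (inNeighbors N.G i).Nonempty) (k : ℤ) :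
    ∃ t ∈ Set.Icc (k - N.τ) k, t ∈ e.upd i ∧ e.ignored i k = e.ignored i t ∧
      ∀ j ∈ inNeighbors N.G i, k - (e.delay i j k : ℤ) = t - (e.delay i j t : ℤ) := by
  classical
  obtain ⟨j₀, hj₀⟩ := hne
  have hex : ∃ n : ℕ, k - n ∈ e.upd i := by
    by_contra! hnone
    have hdelay := (h.hold_of_forall_notMem hi (n := N.τ + 1) fun m _ => hnone m).2 j₀ hj₀
    have := h.delay_le i hi j₀ hj₀ k
    omega
  obtain ⟨n, hn, hlast⟩ : ∃ n : ℕ, k - n ∈ e.upd i ∧ ∀ m < n, k - m ∉ e.upd i :=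
    ⟨Nat.find hex, Nat.find_spec hex, fun _ => Nat.find_min hex⟩
  obtain ⟨hignored, hdelay⟩ := h.hold_of_forall_notMem hi hlast
  have hnτ : n ≤ N.τ := by
    have := h.delay_le i hi j₀ hj₀ k
    have := hdelay j₀ hj₀
    omega
  exact ⟨k - n, ⟨by omega, by omega⟩, hn, hignored, fun j hj => by have := hdelay j hj; omega⟩

lemma exists_ignoresExtremes (h : IsRun N M e) (hd : ∀ i j, N.δ i j = d j - d i) (hi : i ∉ M)
    (hne : (inNeighbors N.G i).Nonempty) (k : ℤ) :
    ∃ t ∈ Set.Icc (k - N.τ) k, IgnoresExtremes N.f (inNeighbors N.G i)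
      (fun j => e.usedDeviation N d i j k - e.deviation N d i t) (e.ignored i k) := by
  obtain ⟨t, ht, hupd, hignored, hage⟩ := h.exists_update hi hne k
  refine ⟨t, ht, hignored ▸ (h.update i hi t hupd).congr fun j hj => ?_⟩
  rw [NetworkRun.rel_eq hd, NetworkRun.usedDeviation, NetworkRun.usedDeviation, hage j hj]

lemma usedDeviation_le_of_notMem (h : IsRun N M e) (hi : i ∉ M) (hj : j ∈ inNeighbors N.G i)
    (hjM : j ∉ M) {k : ℤ} (hb : ∀ l ∈ Set.Icc (k - N.τ) k, e.deviation N d j l ≤ b) :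
    e.usedDeviation N d i j k ≤ b := by
  have htrue : e.usedDeviation N d i j k = e.deviation N d j (k - (e.delay i j k : ℤ)) := by
    simp only [NetworkRun.usedDeviation, NetworkRun.deviation, NetworkRun.pSeen, NetworkRun.p,
      h.truthful i j _ (.inl hjM)]
  have := h.delay_le i hi j hj k
  exact htrue ▸ hb _ ⟨by omega, by omega⟩

lemma usedDeviation_le_of_notMem_ignored (h : IsRun N M e) (hM : M.card ≤ N.f)
    (hd : ∀ i j, N.δ i j = d j - d i) (hi : i ∉ M) {k : ℤ}
    (hb : ∀ l ∉ M, ∀ s ∈ Set.Icc (k - N.τ) k, e.deviation N d l s ≤ b)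
    (hj : j ∈ inNeighbors N.G i) (hjI : j ∉ e.ignored i k) : e.usedDeviation N d i j k ≤ b := by
  obtain ⟨t, ht, hfilter⟩ := h.exists_ignoresExtremes hd hi ⟨j, hj⟩ k
  exact (sub_le_sub_iff_right _).1 <| hfilter.le_of_forall_le hM (sub_nonneg.2 (hb i hi t ht))
    (fun l hl hlM => sub_le_sub_right (h.usedDeviation_le_of_notMem hi hl hlM (hb l hlM)) _) hj hjI

lemma exists_usedDeviation_le (h : IsRun N M e) (hM : M.card ≤ N.f)
    (hd : ∀ i j, N.δ i j = d j - d i) (hi : i ∉ M) {k : ℤ} {A : Finset V}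
    (hA : A ⊆ inNeighbors N.G i) (hcard : 2 * N.f + 1 ≤ A.card)
    (hb : ∀ l ∈ A, l ∉ M → ∀ s ∈ Set.Icc (k - N.τ) k, e.deviation N d l s ≤ b) :
    ∃ j ∈ inNeighbors N.G i, j ∉ e.ignored i k ∧ e.usedDeviation N d i j k ≤ b := by
  have hne : A.Nonempty := Finset.card_pos.1 (by omega)
  obtain ⟨t, -, hfilter⟩ := h.exists_ignoresExtremes hd hi (hne.mono hA) k
  obtain ⟨j, hj, hjI, hle⟩ := hfilter.exists_le (b := b - e.deviation N d i t) hM hA hcard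
    fun l hl hlM => sub_le_sub_right (h.usedDeviation_le_of_notMem hi (hA hl) hlM (hb l hl hlM)) _
  exact ⟨j, hj, hjI, (sub_le_sub_iff_right _).1 hle⟩

lemma step_le (h : IsRun N M e) (hM : M.card ≤ N.f) (hd : ∀ i j, N.δ i j = d j - d i)
    (hs : N.StepBound i (c i) η) {k : ℕ}
    (hb : Confined M N.τ (e.deviation N d) (e.extrapolation N d c) (Set.Iic b) k) (hi : i ∉ M) :
    e.deviation N d i (k + 1 : ℕ) ≤ b - η * (b - e.extrapolation N d c i k) ∧
    e.extrapolation N d c i (k + 1) ≤ b - η * (b - e.extrapolation N d c i k) ∧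
    ∀ j ∈ inNeighbors N.G i, j ∉ e.ignored i k →
      e.extrapolation N d c i (k + 1) ≤ b - η * (b - e.usedDeviation N d i j k) := by
  classical
  have hposition : e.deviation N d i (k + 1 : ℕ) =
      e.deviation N d i k + N.T * e.q N i k + N.T ^ 2 / 2 * e.u i k := by
    simp only [NetworkRun.deviation, NetworkRun.p, NetworkRun.q, Nat.cast_succ, h.position i k]
    push_cast
    ring
  have hstate : e.extrapolation N d c i (k + 1) =
      e.deviation N d i k + N.T * e.q N i k + N.T ^ 2 / 2 * e.u i k
        + c i * (e.q N i k + N.T * e.u i k) := by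
    rw [NetworkRun.extrapolation, hposition]
    simp only [NetworkRun.q, Nat.cast_succ, h.velocity i k]
    ring
  have hcontrol : e.u i k = ∑ j ∈ inNeighbors N.G i \ e.ignored i k,
      N.a k i j * (e.usedDeviation N d i j k - e.deviation N d i k) - N.α i * e.q N i k := by
    simp only [h.control i hi k, NetworkRun.rel_eq hd]
  obtain ⟨hp, hy, hz⟩ := hs k _ Finset.sdiff_subset _ _ _ _ b hcontrol
    ((hb i hi).1 k ⟨by simp, le_rfl⟩) (hb i hi).2 fun j hj =>
      h.usedDeviation_le_of_notMem_ignored hM hd hi (fun l hl => (hb l hl).1)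
        (Finset.mem_sdiff.1 hj).1 (Finset.mem_sdiff.1 hj).2
  rw [← hposition] at hp
  rw [← hstate] at hy hz
  exact ⟨hp, hy, fun j hj hjI => hz j (Finset.mem_sdiff.2 ⟨hj, hjI⟩)⟩

lemma gapPropagation (h : IsRun N M e) (hM : M.card ≤ N.f) (hd : ∀ i j, N.δ i j = d j - d i)
    (hη₀ : 0 < η) (hη₁ : η ≤ 1) (hs : ∀ i, N.StepBound i (c i) η) :
    GapPropagation N.G M (2 * N.f + 1) N.τ η (e.deviation N d) (e.extrapolation N d c) := by
  have hgap : ∀ {b ε x : ℝ}, x ≤ b - ε → b - η * (b - x) ≤ b - η * ε := fun hx =>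
    sub_le_sub_left (mul_le_mul_of_nonneg_left (le_sub_comm.1 hx) hη₀.le) _
  refine ⟨hη₀, hη₁, fun hb hi hε => ?_, fun hb hi hε => ?_, fun hb hi hA hcard hε => ?_⟩
  · exact (h.step_le hM hd (hs _) hb hi).1.trans (hgap hε)
  · exact (h.step_le hM hd (hs _) hb hi).2.1.trans (hgap hε)
  · obtain ⟨j, hj, hjI, hle⟩ := h.exists_usedDeviation_le hM hd hi hA hcard hε
    exact ((h.step_le hM hd (hs _) hb hi).2.2 j hj hjI).trans (hgap hle)

lemma gapPropagation_neg (h : IsRun N M e) (hM : M.card ≤ N.f)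
    (hd : ∀ i j, N.δ i j = d j - d i) (hη₀ : 0 < η) (hη₁ : η ≤ 1)
    (hs : ∀ i, N.StepBound i (c i) η) :
    GapPropagation N.G M (2 * N.f + 1) N.τ η (-e.deviation N d) (-e.extrapolation N d c) := by
  have hd' : ∀ i j, N.mirror.δ i j = (-d) j - (-d) i := fun i j => by
    simp only [VehicleNetwork.mirror, hd, Pi.neg_apply]
    ring
  rw [← NetworkRun.deviation_mirror, ← NetworkRun.extrapolation_mirror]
  exact h.mirror.gapPropagation hM hd' hη₀ hη₁ hs

end IsRun

section ExponentialRate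

variable {V : Type*} {N : VehicleNetwork V} {e : NetworkRun V} {M : Finset V} {d c : V → ℝ}
  {m b : ℝ} {k : ℕ} {i j : V}

lemma abs_relative_position_sub_le (hd : ∀ i j, N.δ i j = d j - d i)
    (h : Confined M N.τ (e.deviation N d) (e.extrapolation N d c) (Set.Icc m b) k)
    (hi : i ∉ M) (hj : j ∉ M) : |e.x j k - e.x i k - N.δ i j| ≤ b - m := by
  have hdist := Real.dist_le_of_mem_Icc ((h j hj).1 k ⟨by simp, le_rfl⟩)
    ((h i hi).1 k ⟨by simp, le_rfl⟩)
  rw [Real.dist_eq] at hdist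
  convert hdist using 2
  simp only [NetworkRun.deviation, NetworkRun.p, hd]
  ring

lemma abs_velocity_sub_le (hc : 0 < c i)
    (h : Confined M N.τ (e.deviation N d) (e.extrapolation N d c) (Set.Icc m b) k)
    (hi : i ∉ M) : |e.v i k - N.r| ≤ (c i)⁻¹ * (b - m) := by
  have hdist := Real.dist_le_of_mem_Icc (h i hi).2 ((h i hi).1 k ⟨by simp, le_rfl⟩)
  rw [Real.dist_eq, NetworkRun.extrapolation, add_sub_cancel_left, abs_mul, abs_of_pos hc] at hdist
  exact (le_inv_mul_iff₀ hc).2 hdist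

lemma exponentialRate_of_isRobust [Fintype V] (hN : WellPosed N) (hgain : GainCondition N)
    (hG : IsRobust N.G (2 * N.f + 1) 1) : ExponentialRate N := by
  obtain ⟨d, hd⟩ := exists_eq_sub_of_cocycle N.δ hN.2.2.1
  obtain ⟨c, η, hc, hη₀, hη₁, hs⟩ := VehicleNetwork.exists_stepBound hN hgain
  obtain ⟨K, hK⟩ := Finite.exists_le fun i => (c i)⁻¹
  obtain ⟨L, hL⟩ : ∃ L, L = contractionPeriod (Fintype.card V) N.τ := ⟨_, rfl⟩
  have hL₀ : L ≠ 0 := by rw [hL, contractionPeriod]; omega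
  have hηL₀ : 0 < η ^ L := pow_pos hη₀ L
  have hηL₁ : η ^ L ≤ 1 := pow_le_one₀ hη₀.le hη₁
  obtain ⟨ρ, hρ₀, hρ₁, hρ⟩ := exists_pow_div_le_mul_pow (θ := 1 - η ^ L / 2)
    (by linarith) (by linarith) hL₀
  refine ⟨ρ, hρ₀, hρ₁, fun M hM e he => ?_⟩
  obtain ⟨w, hw, hspread⟩ := exists_confined_Icc_of_isRobust hG
    (he.gapPropagation hM hd hη₀ hη₁ hs) (he.gapPropagation_neg hM hd hη₀ hη₁ hs) hL
  refine ⟨max 1 K * ((1 - η ^ L / 2)⁻¹ * w), fun k => ?_⟩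
  obtain ⟨m, b, hwidth, hconf⟩ := hspread k
  have hrate : b - m ≤ (1 - η ^ L / 2)⁻¹ * w * ρ ^ k := by
    rw [hwidth, mul_right_comm]
    exact mul_le_mul_of_nonneg_right (hρ k) hw
  have hbound₀ : 0 ≤ (1 - η ^ L / 2)⁻¹ * w * ρ ^ k :=
    mul_nonneg (mul_nonneg (inv_nonneg.2 (by linarith)) hw) (pow_nonneg hρ₀.le k)
  rw [mul_assoc]
  refine ⟨fun i hi j hj => ?_, fun i hi => ?_⟩
  · exact (abs_relative_position_sub_le hd hconf hi hj).trans
      (hrate.trans (le_mul_of_one_le_left hbound₀ (le_max_left _ _)))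
  · calc |e.v i k - N.r| ≤ (c i)⁻¹ * (b - m) := abs_velocity_sub_le (hc i) hconf hi
      _ ≤ (c i)⁻¹ * ((1 - η ^ L / 2)⁻¹ * w * ρ ^ k) :=
        mul_le_mul_of_nonneg_left hrate (inv_nonneg.2 (hc i).le)
      _ ≤ max 1 K * ((1 - η ^ L / 2)⁻¹ * w * ρ ^ k) :=
        mul_le_mul_of_nonneg_right ((hK i).trans (le_max_right _ _)) hbound₀

lemma ExponentialRate.resilientMovement [Fintype V] (h : ExponentialRate N) :
    ResilientMovement N := by
  obtain ⟨ρ, hρ₀, hρ₁, h⟩ := h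
  intro M hM e he
  obtain ⟨C, hC⟩ := h M hM e he
  have hlim : Tendsto (fun k : ℕ => C * ρ ^ k) atTop (𝓝 0) := by
    simpa using (tendsto_pow_atTop_nhds_zero_of_lt_one hρ₀.le hρ₁).const_mul C
  have htendsto : ∀ (s : ℕ → ℝ) (l : ℝ), (∀ k, |s k - l| ≤ C * ρ ^ k) →
      Tendsto s atTop (𝓝 l) := fun s l hs =>
    tendsto_iff_dist_tendsto_zero.2 (squeeze_zero (fun _ => dist_nonneg) hs hlim)
  exact ⟨fun i hi j hj => htendsto _ _ fun k => (hC k).1 i hi j hj,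
    fun i hi => htendsto _ _ fun k => (hC k).2 i hi⟩

end ExponentialRate

namespace VehicleNetwork

variable {V : Type*} [Fintype V] (N : VehicleNetwork V) (M : Finset V)

/-- The relative position of `j` that `i` calculates without delays, when `s` holds the positions
and velocities of all vehicles. -/
def relPos (s : V → ℝ × ℝ) (i j : V) : ℝ := (s j).1 - (s i).1 - N.δ i j

/-- A choice of ignored neighbours in the state `s`. -/
noncomputable def ignoredAt (s : V → ℝ × ℝ) (i : V) : Finset V :=
  (exists_ignoresExtremes N.f (inNeighbors N.G i) (N.relPos s i)).choose

lemma ignoresExtremes_ignoredAt (s : V → ℝ × ℝ) (i : V) :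
    IgnoresExtremes N.f (inNeighbors N.G i) (N.relPos s i) (N.ignoredAt s i) :=
  (exists_ignoresExtremes N.f (inNeighbors N.G i) (N.relPos s i)).choose_spec

open Classical in
/-- The control inputs at time `k` in the state `s`, without delays, when the vehicles in `M` do not
accelerate. -/
noncomputable def inputAt (k : ℕ) (s : V → ℝ × ℝ) (i : V) : ℝ :=
  if i ∈ M then 0 else
    (∑ j ∈ inNeighbors N.G i \ N.ignoredAt s i, N.a k i j * N.relPos s i j)
      - N.α i * ((s i).2 - N.r)

/-- The positions and velocities at all times under `inputAt`, from the initial positions `x₀` and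
with the desired velocity at the start. -/
noncomputable def stateAt (x₀ : V → ℝ) : ℕ → V → ℝ × ℝ
  | 0 => fun i => (x₀ i, N.r)
  | k + 1 => fun i =>
    ((stateAt x₀ k i).1 + N.T * (stateAt x₀ k i).2 + N.T ^ 2 / 2 * N.inputAt M k (stateAt x₀ k) i,
      (stateAt x₀ k i).2 + N.T * N.inputAt M k (stateAt x₀ k) i)

/-- The run with permanent updates, without delays and with truthful broadcasts, where the vehicles
in `M` do not accelerate. Before the initial time, everything is as at that time. -/
noncomputable def undelayedRun (x₀ : V → ℝ) : NetworkRun V where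
  x i k := (N.stateAt M x₀ k.toNat i).1
  v i k := (N.stateAt M x₀ k.toNat i).2
  u i k := N.inputAt M k.toNat (N.stateAt M x₀ k.toNat) i
  seen _ j k := (N.stateAt M x₀ k.toNat j).1
  upd _ := Set.univ
  delay _ _ _ := 0
  ignored i k := N.ignoredAt (N.stateAt M x₀ k.toNat) i

lemma rel_undelayedRun (x₀ : V → ℝ) (i j : V) (k : ℤ) :
    (N.undelayedRun M x₀).rel N i j k = N.relPos (N.stateAt M x₀ k.toNat) i j := by
  simp only [NetworkRun.rel, NetworkRun.pSeen, NetworkRun.p, undelayedRun, relPos, Nat.cast_zero,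
    sub_zero]
  ring

lemma isRun_undelayedRun (x₀ : V → ℝ) : IsRun N M (N.undelayedRun M x₀) where
  position _ _ := rfl
  velocity _ _ := rfl
  truthful _ _ _ _ := rfl
  delay_le _ _ _ _ _ := Nat.zero_le _
  update i _ k _ := by
    simp only [rel_undelayedRun]
    exact N.ignoresExtremes_ignoredAt _ i
  hold _ _ k hk := absurd (Set.mem_univ k) hk
  control i hi k := by
    simp only [rel_undelayedRun]
    exact if_neg hi

variable {N M} {d x₀ : V → ℝ} {κ : ℝ} {A : Finset V}

lemma stateAt_of_reachable_subset (hd : ∀ i j, N.δ i j = d j - d i)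
    (hA : reachable N.G (N.f + 1) A ⊆ M) (h₀ : ∀ i ∈ A, x₀ i = d i + κ) (k : ℕ) :
    ∀ i ∈ A, N.stateAt M x₀ k i = (d i + κ + k * N.T * N.r, N.r) := by
  classical
  induction k with
  | zero => exact fun i hi => by simp [stateAt, h₀ i hi]
  | succ k ih =>
    intro i hi
    have hinput : N.inputAt M k (N.stateAt M x₀ k) i = 0 := by
      by_cases hiM : i ∈ M
      · exact if_pos hiM
      rw [inputAt, if_neg hiM, ih i hi, sub_self, mul_zero, sub_zero]
      refine Finset.sum_eq_zero fun j hj => mul_eq_zero_of_right _ ?_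
      -- The few neighbours outside of `A` are filtered out like malicious ones.
      have houtside : (inNeighbors N.G i \ A).card ≤ N.f := by
        by_contra! hlt
        have hcard : N.f + 1 ≤ (inNeighbors N.G i \ A).card := hlt
        exact hiM (hA (mem_reachable.2 ⟨hi, by convert hcard⟩))
      refine (N.ignoresExtremes_ignoredAt (N.stateAt M x₀ k) i).eq_zero houtside
        (fun l hl hlA => ?_) (Finset.mem_sdiff.1 hj).1 (Finset.mem_sdiff.1 hj).2
      have hlA' : l ∈ A := by simpa [hl] using hlA
      rw [relPos, ih l hlA', ih i hi, hd]
      ring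
    simp only [stateAt, hinput, ih i hi]
    ext
    · push_cast
      ring
    · simp

end VehicleNetwork

namespace ResilientMovement

variable {V : Type*} [Fintype V] {N : VehicleNetwork V}

lemma subset_or_subset_of_reachable_subset (h : ResilientMovement N)
    (hδ : ∀ i j l, N.δ i j + N.δ j l = N.δ i l) {M A₁ A₂ : Finset V} (hM : M.card ≤ N.f)
    (hdisj : Disjoint A₁ A₂) (hA₁ : reachable N.G (N.f + 1) A₁ ⊆ M)
    (hA₂ : reachable N.G (N.f + 1) A₂ ⊆ M) : A₁ ⊆ M ∨ A₂ ⊆ M := by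
  classical
  obtain ⟨d, hd⟩ := exists_eq_sub_of_cocycle N.δ hδ
  by_contra! hnot
  obtain ⟨⟨i, hi, hiM⟩, j, hj, hjM⟩ := hnot.imp Finset.not_subset.1 Finset.not_subset.1
  -- The two groups start in formation, but shifted by one unit against each other.
  set x₀ : V → ℝ := fun l => d l + if l ∈ A₂ then 1 else 0 with hx₀
  have hstate₁ := VehicleNetwork.stateAt_of_reachable_subset (x₀ := x₀) (κ := 0) hd hA₁
    fun l hl => by simp [hx₀, Finset.disjoint_left.1 hdisj hl]
  have hstate₂ := VehicleNetwork.stateAt_of_reachable_subset (x₀ := x₀) (κ := 1) hd hA₂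
    fun l hl => by simp [hx₀, hl]
  have hlim := (h M hM _ (N.isRun_undelayedRun M x₀)).1 i hiM j hjM
  have hconst : ∀ k : ℕ, (N.undelayedRun M x₀).x j k - (N.undelayedRun M x₀).x i k =
      N.δ i j + 1 := fun k => by
    simp only [VehicleNetwork.undelayedRun, Int.toNat_natCast, hstate₁ k i hi, hstate₂ k j hj, hd]
    ring
  simp only [hconst] at hlim
  linarith [tendsto_nhds_unique hlim tendsto_const_nhds]

lemma lt_card (h : ResilientMovement N) (hδ : ∀ i j l, N.δ i j + N.δ j l = N.δ i l)
    (hn : 1 < Fintype.card V) : N.f + 1 < Fintype.card V := by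
  classical
  by_contra! hle
  obtain ⟨i, j, hij⟩ := Fintype.exists_pair_of_one_lt_card hn
  have hempty : ∀ l : V, reachable N.G (N.f + 1) {l} ⊆ ∅ := fun l m hm => by
    have hcard := (mem_reachable.1 hm).2
    have := Finset.card_lt_univ_of_notMem (s := inNeighbors N.G m \ {l}) (x := l) (by simp)
    have : N.f + 1 ≤ (inNeighbors N.G m \ {l}).card := by convert hcard
    omega
  have := h.subset_or_subset_of_reachable_subset hδ (Nat.zero_le _)
    (Finset.disjoint_singleton.2 hij) (hempty i) (hempty j)
  simp at this

lemma isRobust (h : ResilientMovement N) (hδ : ∀ i j l, N.δ i j + N.δ j l = N.δ i l)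
    (hn : 1 < Fintype.card V) : IsRobust N.G (N.f + 1) (N.f + 1) := by
  classical
  refine ⟨h.lt_card hδ hn, h.lt_card hδ hn, fun A₁ A₂ _ _ hdisj => ?_⟩
  by_contra! hnot
  obtain ⟨hne₁, hne₂, hcard⟩ := hnot
  have hsub : ∀ A, reachable N.G (N.f + 1) A ⊆ A := fun A => Finset.filter_subset _ _
  rcases h.subset_or_subset_of_reachable_subset hδ
    ((Finset.card_union_le _ _).trans (Nat.lt_succ_iff.1 hcard)) hdisj
    Finset.subset_union_left Finset.subset_union_right with hA | hA
  · exact hne₁ ((hsub A₁).antisymm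
      (Disjoint.left_le_of_le_sup_right hA (hdisj.mono_right (hsub A₂))))
  · exact hne₂ ((hsub A₂).antisymm
      (Disjoint.left_le_of_le_sup_left hA (hdisj.symm.mono_right (hsub A₁))))

end ResilientMovement

theorem theorem1 {V : Type*} [Fintype V] (N : VehicleNetwork V)
    (hn : 1 < Fintype.card V) (hN : WellPosed N) :
    (GainCondition N → IsRobust N.G (2 * N.f + 1) 1 →
      ResilientMovement N ∧ ExponentialRate N) ∧
    (ResilientMovement N → IsRobust N.G (N.f + 1) (N.f + 1)) := by
  refine ⟨fun hgain hG => ?_, fun h => h.isRobust hN.2.2.1 hn⟩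
  have hrate : ExponentialRate N := exponentialRate_of_isRobust hN hgain hG
  exact ⟨hrate.resilientMovement, hrate⟩
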